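/- For a permutation $\pi$ of an $m$-element set, let $F(\pi)$ be the number of pairs $(\tau,\sigma)$ of permutations of that set with $\tau^2=\sigma^2=\mathrm{id}$ and $\pi=\tau\circ\sigma$ (the identity is allowed as an involution). For $n\ge 1$ let $\mathbb{P}^*_n$ be the law of the random permutation obtained as follows: let $X_1,\dots,X_n$ be independent, with $X_k$ Poisson distributed with mean $1/k$; put $m=X_1+2X_2+\cdots+nX_n$; given $(X_1,\dots,X_n)$, choose $\pi$ uniformly among all permutations of $\{1,\dots,m\}$ that have exactly $X_k$ cycles of length $k$ for each $k=1,\dots,n$. Let $\Phi$ be the distribution function of the standard normal distribution. Theorem. For every $x\in\mathbb{R}$, $$\lim_{n\to\infty}\mathbb{P}^*_n\left(\frac{\log F(\pi)-\frac12(\log n)^2}{\sqrt{\frac13(\log n)^3}}\le x\right)=\Phi(x).$$ That is, under $\mathbb{P}^*_n$ the random variable $\bigl(\log F(\pi)-\frac12(\log n)^2\bigr)/\sqrt{\frac13(\log n)^3}$ converges in distribution to the standard normal. -/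

import Mathlib

open MeasureTheory ProbabilityTheory
open scoped NNReal

namespace InvFact

/-- The set of all permutations: pairs of a size `m` and a permutation of an `m`-element set. -/
def AnyPerm : Type := Σ m : ℕ, Equiv.Perm (Fin m)

instance : MeasurableSpace AnyPerm := ⊤

instance : DiscreteMeasurableSpace AnyPerm := ⟨fun _ => trivial⟩

/-- The number of `k`-cycles of `p`; fixed points are the `1`-cycles. -/
def numCycles (p : AnyPerm) (k : ℕ) : ℕ := p.2.partition.parts.count k

/-- The number of factorizations of `p` into two involutions: the number of pairs `(τ, σ)` of
permutations of the same set with `τ² = σ² = 1` (the identity is allowed) and `p = τ ∘ σ`. -/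
def numFactorizations (p : AnyPerm) : ℕ :=
  (Finset.univ.filter fun q : Equiv.Perm (Fin p.1) × Equiv.Perm (Fin p.1) =>
    q.1 * q.1 = 1 ∧ q.2 * q.2 = 1 ∧ p.2 = q.1 * q.2).card

/-- Permutations of `m = ∑ k · c_k` points with `c_k` cycles of length `k` for `1 ≤ k ≤ n`
(hence with no longer cycles). The number `c_k` is stored as `c i` with `k = i + 1`. -/
def permsOfType {n : ℕ} (c : Fin n → ℕ) : Set AnyPerm :=
  {p | p.1 = ∑ i : Fin n, ((i : ℕ) + 1) * c i ∧ ∀ i : Fin n, numCycles p ((i : ℕ) + 1) = c i}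

/-- The joint law of independent variables `X_1, …, X_n` with `X_k` Poisson of mean `1 / k`
(`X_k` is the coordinate `i` with `k = i + 1`). -/
noncomputable def cycleCountLaw (n : ℕ) : Measure (Fin n → ℕ) :=
  Measure.pi fun i => poissonMeasure (1 / ((i : ℕ) + 1 : ℝ≥0))

/-- The law of the random permutation: draw the cycle counts from `cycleCountLaw n`, then draw a
permutation uniformly among all permutations with these cycle counts. -/
noncomputable def permLaw (n : ℕ) : Measure AnyPerm :=
  (cycleCountLaw n).bind fun c => uniformOn (permsOfType c)

end InvFact

/-! An involution `τ` is the first factor of a factorization of `g` exactly when it inverts `g`, and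
it determines the other factor. Two such `τ` differ by an element of the centralizer. Conversely, an
inverting involution that preserves every cycle may be multiplied by independent rotations of the
cycles. With `c_k` cycles of length `k` this gives `∏ k ^ c_k ≤ F ≤ ∏ k ^ c_k * c_k!`
(`prod_cycleType_le_card_factorizations`, `card_factorizations_le_card_centralizer`), so `log F`
lies between `logWeight` and `logWeight + logExcess`.

The weight `∑ X_k log k` is compound Poisson, with mean `∑ log k / k = (log n)² / 2 + O(1)` and
variance `∑ (log k)² / k = (log n)³ / 3 + O(1)`. Its jumps are at most `log n`, which is negligible
against the standard deviation, so its normalized characteristic function tends to the Gaussian one.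
The excess has bounded mean, because `E log X_k! ≤ E X_k (X_k - 1) = 1 / k²`. Both bounds thus have
the same normal limit, and the distribution functions are squeezed. -/

namespace InvFact

/-! ### Reflecting every cycle of a permutation. -/

section InvertingInvolutions

variable {α : Type*} (g : Equiv.Perm α)

/-- The points `g ^ (-i) r` for `x = g ^ i r`, where `r` is a chosen representative of the cycle
of `x`. -/
noncomputable def reflectFun (x : α) : α :=
  let r := Quotient.mk (Equiv.Perm.SameCycle.setoid g) x
  (g ^ (-(Classical.choose (Quotient.mk_out (s := Equiv.Perm.SameCycle.setoid g) x)))) r.out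

/-- The choice of exponent is harmless: if `g ^ j` and `g ^ i` agree at the representative, applying
`g ^ (-i - j)` shows that `g ^ (-i)` and `g ^ (-j)` agree there too. -/
lemma reflectFun_zpow_out (r : Quotient (Equiv.Perm.SameCycle.setoid g)) (i : ℤ) :
    reflectFun g ((g ^ i) r.out) = (g ^ (-i)) r.out := by
  have hr : Quotient.mk (Equiv.Perm.SameCycle.setoid g) ((g ^ i) r.out) = r := by
    conv_rhs => rw [← Quotient.out_eq r]
    exact Quotient.sound (s := Equiv.Perm.SameCycle.setoid g)
      (Equiv.Perm.SameCycle.symm ⟨i, rfl⟩)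
  have hj := Classical.choose_spec
    (Quotient.mk_out (s := Equiv.Perm.SameCycle.setoid g) ((g ^ i) r.out))
  unfold reflectFun
  generalize Classical.choose
    (Quotient.mk_out (s := Equiv.Perm.SameCycle.setoid g) ((g ^ i) r.out)) = j at hj ⊢
  simp only [hr] at hj ⊢
  have := congrArg (g ^ (-i + -j)) hj
  simpa only [← Equiv.Perm.mul_apply, ← zpow_add, neg_add_cancel_right, neg_add_cancel_comm]
    using this.symm

lemma exists_zpow_out (x : α) :
    ∃ (r : Quotient (Equiv.Perm.SameCycle.setoid g)) (i : ℤ), x = (g ^ i) r.out := by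
  obtain ⟨i, hi⟩ := Quotient.mk_out (s := Equiv.Perm.SameCycle.setoid g) x
  exact ⟨_, i, hi.symm⟩

/-- Every permutation is inverted by an involution that preserves each of its cycles. -/
lemma exists_involution_inverting :
    ∃ t : Equiv.Perm α, t * t = 1 ∧ (∀ (i : ℤ) x, t ((g ^ i) x) = (g ^ (-i)) (t x)) ∧
      ∀ x, ∃ i : ℤ, t x = (g ^ i) x := by
  have hinv : Function.Involutive (reflectFun g) := fun x => by
    obtain ⟨r, i, rfl⟩ := exists_zpow_out g x
    rw [reflectFun_zpow_out, reflectFun_zpow_out, neg_neg]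
  refine ⟨hinv.toPerm, Equiv.ext fun x => hinv x, fun i x => ?_, fun x => ?_⟩
  · obtain ⟨r, j, rfl⟩ := exists_zpow_out g x
    change reflectFun g _ = (g ^ (-i)) (reflectFun g _)
    rw [← Equiv.Perm.mul_apply, ← zpow_add, reflectFun_zpow_out, reflectFun_zpow_out,
      ← Equiv.Perm.mul_apply, ← zpow_add, neg_add]
  · obtain ⟨r, j, rfl⟩ := exists_zpow_out g x
    refine ⟨-j + -j, ?_⟩
    change reflectFun g _ = _
    rw [reflectFun_zpow_out, ← Equiv.Perm.mul_apply, ← zpow_add, neg_add_cancel_right]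

end InvertingInvolutions

/-! ### Two-sided bounds on the number of factorizations. -/

section Bounds

variable {α : Type*} [Fintype α] [DecidableEq α] (g : Equiv.Perm α)

/-- The factorizations of `g` into two involutions. -/
def factorizations : Finset (Equiv.Perm α × Equiv.Perm α) :=
  Finset.univ.filter fun q => q.1 * q.1 = 1 ∧ q.2 * q.2 = 1 ∧ g = q.1 * q.2

/-- Each first factor conjugates `g` to its inverse, so the product of two first factors commutes
with `g`. Multiplying by a fixed one injects the factorizations into the centralizer. -/
lemma card_factorizations_le_card_centralizer :
    (factorizations g).card ≤ Nat.card (Subgroup.centralizer {g}) := by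
  rcases (factorizations g).eq_empty_or_nonempty with h | ⟨q₀, h₀⟩
  · simp [h]
  have key : ∀ q ∈ factorizations g, q.1⁻¹ = q.1 ∧ q.2 = q.1 * g ∧ q.1 * g * q.1 = g⁻¹ := by
    intro q hq
    obtain ⟨h1, h2, h3⟩ := (Finset.mem_filter.1 hq).2
    have e : q.2 = q.1 * g := by rw [h3, ← mul_assoc, h1, one_mul]
    refine ⟨inv_eq_of_mul_eq_one_left h1, e, ?_⟩
    rw [e] at h2
    exact eq_inv_of_mul_eq_one_left (by simpa [mul_assoc] using h2)
  rw [← Fintype.card_coe, ← Nat.card_eq_fintype_card]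
  have hmem : ∀ q : factorizations g, q₀.1 * q.1.1 ∈ Subgroup.centralizer {g} := fun q => by
    obtain ⟨a1, -, a3⟩ := key _ h₀
    obtain ⟨b1, -, b3⟩ := key _ q.2
    rw [Subgroup.mem_centralizer_singleton_iff]
    have hb : q.1.1 * g = g⁻¹ * q.1.1 := by
      rw [← b3, mul_assoc _ q.1.1 q.1.1]
      nth_rw 4 [← b1]
      simp
    have ha : q₀.1 * g⁻¹ = g * q₀.1 := by
      rw [← a3]
      have : q₀.1 * q₀.1 = 1 := by nth_rw 2 [← a1]; simp
      rw [← mul_assoc, ← mul_assoc, this, one_mul]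
    rw [mul_assoc, hb, ← mul_assoc, ha, mul_assoc]
  refine Nat.card_le_card_of_injective (fun q => ⟨q₀.1 * q.1.1, hmem q⟩) fun q q' h => ?_
  have h1 : q.1.1 = q'.1.1 := mul_left_cancel (congrArg Subtype.val h)
  refine Subtype.ext (Prod.ext h1 ?_)
  rw [(key _ q.2).2.1, (key _ q'.2).2.1, h1]

/-- The first factors used are `t * k v`, where `v` picks a power of each nontrivial cycle
independently. Fixed points would only contribute factors `1`. -/
lemma prod_cycleType_le_card_factorizations :
    g.cycleType.prod ≤ (factorizations g).card := by
  obtain ⟨t, ht, htg, htx⟩ := exists_involution_inverting g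
  have hcard : Fintype.card ((c : g.cycleFactorsFinset) → Subgroup.zpowers c.val)
      = g.cycleType.prod := by
    rw [Fintype.card_pi, Finset.univ_eq_attach,
      g.cycleFactorsFinset.prod_attach (fun i ↦ Fintype.card (Subgroup.zpowers i)),
      Equiv.Perm.cycleType, Finset.prod_map_val]
    refine Finset.prod_congr rfl (fun x hx ↦ ?_)
    rw [Fintype.card_zpowers, (Equiv.Perm.mem_cycleFactorsFinset_iff.mp hx).1.orderOf,
      Function.comp_apply]
  let k := fun v : (c : g.cycleFactorsFinset) → Subgroup.zpowers c.val =>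
    Equiv.Perm.OnCycleFactors.kerParam g (1, v)
  have hkinj : Function.Injective k := fun v w h =>
    (Prod.ext_iff.1 (Equiv.Perm.OnCycleFactors.kerParam_injective g h)).2
  have hkx : ∀ v x, ∃ i : ℤ, k v x = (g ^ i) x := fun v x => by
    simp only [k]
    rw [Equiv.Perm.OnCycleFactors.kerParam_apply]
    split_ifs with hx
    · obtain ⟨i, hi⟩ := Subgroup.mem_zpowers_iff.1 (v ⟨g.cycleOf x, hx⟩).2
      exact ⟨i, by rw [← hi]; simp⟩
    · exact ⟨0, by simp⟩
  have hkc : ∀ v, Commute (k v) g := fun v =>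
    Subgroup.mem_centralizer_singleton_iff.1
      (Equiv.Perm.OnCycleFactors.kerParam_range_le_centralizer ⟨_, rfl⟩)
  -- Since `t x` lies in the cycle of `x`, `k v` moves both by the same power of `g`; conjugation by
  -- `t` inverts that power, so the two rotations cancel.
  have hsq : ∀ v, (t * k v) * (t * k v) = 1 := fun v => by
    ext x
    obtain ⟨i, hi⟩ := hkx v x
    obtain ⟨j, hj⟩ := htx x
    simp only [Equiv.Perm.mul_apply, Equiv.Perm.one_apply]
    have hc : ∀ (n : ℤ) y, k v ((g ^ n) y) = (g ^ n) (k v y) := fun n y =>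
      Equiv.congr_fun ((hkc v).zpow_right n) y
    have hkt : k v (t x) = (g ^ i) (t x) := by
      rw [hj, hc, hi, ← Equiv.Perm.mul_apply, ← Equiv.Perm.mul_apply, ← zpow_add, ← zpow_add,
        add_comm]
    rw [hi, htg, hc, hkt, zpow_neg, Equiv.Perm.inv_def, Equiv.symm_apply_apply]
    exact Equiv.congr_fun ht x
  rw [← hcard, ← Fintype.card_coe]
  have hgsq : ∀ v, (t * k v) * g * ((t * k v) * g) = 1 := fun v => by
    have h : t * g = g⁻¹ * t := Equiv.ext fun x => by simpa using htg 1 x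
    have hm : t * k v * g = g⁻¹ * (t * k v) := by
      rw [mul_assoc t, (hkc v).eq, ← mul_assoc t, h, mul_assoc]
    calc t * k v * g * (t * k v * g) = g⁻¹ * (t * k v) * (t * k v * g) := by rw [hm]
      _ = g⁻¹ * (t * k v * (t * k v)) * g := by simp only [mul_assoc]
      _ = 1 := by rw [hsq, mul_one, inv_mul_cancel]
  refine Fintype.card_le_of_injective (fun v => ⟨(t * k v, t * k v * g), ?_⟩) fun v w h => ?_
  · exact Finset.mem_filter.2 ⟨Finset.mem_univ _, hsq v, hgsq v,
      by rw [← mul_assoc, hsq, one_mul]⟩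
  · exact hkinj (mul_left_cancel (congrArg (fun q => q.1.1) h))

end Bounds
-- Permutations with prescribed cycle counts.
section PermsOfType

variable {n : ℕ}

/-- The multiset of cycle lengths with `c i` parts equal to `i + 1`. -/
def cycleLengths (c : Fin n → ℕ) : Multiset ℕ :=
  ∑ i : Fin n, Multiset.replicate (c i) ((i : ℕ) + 1)

lemma sum_cycleLengths (c : Fin n → ℕ) :
    (cycleLengths c).sum = ∑ i : Fin n, ((i : ℕ) + 1) * c i := by
  simp [cycleLengths, Multiset.sum_sum, mul_comm]

lemma prod_cycleLengths (c : Fin n → ℕ) :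
    (cycleLengths c).prod = ∏ i : Fin n, ((i : ℕ) + 1) ^ c i := by
  simp [cycleLengths, Multiset.prod_sum]

lemma count_cycleLengths (c : Fin n → ℕ) (i : Fin n) :
    (cycleLengths c).count ((i : ℕ) + 1) = c i := by
  simp [cycleLengths, Multiset.count_sum', Multiset.count_replicate, Fin.val_inj]

lemma mem_cycleLengths {c : Fin n → ℕ} {k : ℕ} (hk : k ∈ cycleLengths c) :
    ∃ i : Fin n, k = (i : ℕ) + 1 := by
  obtain ⟨i, -, hi⟩ := Multiset.mem_sum.1 hk
  exact ⟨i, Multiset.eq_of_mem_replicate hi⟩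

/-- The prescribed counts force an inclusion of multisets; the total size then leaves no room for
further positive parts. -/
lemma parts_eq_cycleLengths {c : Fin n → ℕ} {p : AnyPerm} (hp : p ∈ permsOfType c) :
    p.2.partition.parts = cycleLengths c := by
  obtain ⟨hm, hc⟩ := hp
  have hle : cycleLengths c ≤ p.2.partition.parts := by
    refine Multiset.le_iff_count.2 fun k => ?_
    by_cases hk : k ∈ cycleLengths c
    · obtain ⟨i, rfl⟩ := mem_cycleLengths hk
      rw [count_cycleLengths, ← hc i, numCycles]
    · simp [Multiset.count_eq_zero_of_notMem hk]
  obtain ⟨D, hD⟩ := Multiset.le_iff_exists_add.1 hle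
  have hs := congrArg Multiset.sum hD
  rw [p.2.partition.parts_sum, Multiset.sum_add, sum_cycleLengths, Fintype.card_fin, hm] at hs
  have hD0 : D = 0 := by
    refine Multiset.eq_zero_of_forall_notMem fun k hk => ?_
    have h0 : k ≤ D.sum := Multiset.le_sum_of_mem hk
    have h1 : 0 < k := p.2.partition.parts_pos (hD ▸ Multiset.mem_add.2 (Or.inr hk))
    omega
  rw [hD, hD0, add_zero]

lemma permsOfType_finite (c : Fin n → ℕ) : (permsOfType c).Finite := by
  refine (Set.finite_range
    fun q : Equiv.Perm (Fin (∑ i : Fin n, ((i : ℕ) + 1) * c i)) => (⟨_, q⟩ : AnyPerm)).subset ?_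
  rintro ⟨m, q⟩ ⟨hm, -⟩
  obtain rfl : m = _ := hm
  exact ⟨q, rfl⟩

lemma permsOfType_nonempty (c : Fin n → ℕ) : (permsOfType c).Nonempty := by
  set m := ∑ i : Fin n, ((i : ℕ) + 1) * c i with hm
  have hsplit := Multiset.filter_add_not (2 ≤ ·) (cycleLengths c)
  -- `cycleType` omits fixed points, so the parts equal to `1` are split off and recovered from the
  -- size `m`.
  have hrep : (cycleLengths c).filter (¬ 2 ≤ ·)
      = Multiset.replicate ((cycleLengths c).filter (¬ 2 ≤ ·)).card 1 := by
    refine Multiset.eq_replicate_card.2 fun k hk => ?_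
    obtain ⟨h1, h2⟩ := Multiset.mem_filter.1 hk
    obtain ⟨i, rfl⟩ := mem_cycleLengths h1
    omega
  have hsum := congrArg Multiset.sum hsplit
  rw [Multiset.sum_add, sum_cycleLengths, ← hm] at hsum
  obtain ⟨q, hq⟩ := (Equiv.Perm.exists_with_cycleType_iff (Fin m)
    (m := (cycleLengths c).filter (2 ≤ ·))).2
    ⟨by rw [Fintype.card_fin]; omega, fun a ha => (Multiset.mem_filter.1 ha).2⟩
  refine ⟨⟨m, q⟩, hm, fun i => ?_⟩
  have hparts : q.partition.parts = cycleLengths c := by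
    rw [Equiv.Perm.parts_partition, ← Equiv.Perm.sum_cycleType, hq]
    refine Eq.trans ?_ hsplit
    rw [hrep, Multiset.sum_replicate, smul_eq_mul, mul_one] at hsum
    rw [hrep, Fintype.card_fin]
    congr 2
    omega
  change q.partition.parts.count _ = _
  rw [hparts, count_cycleLengths]

variable {c : Fin n → ℕ} {p : AnyPerm}

lemma prod_cycleType_eq (hp : p ∈ permsOfType c) :
    p.2.cycleType.prod = ∏ i : Fin n, ((i : ℕ) + 1) ^ c i := by
  rw [← prod_cycleLengths, ← parts_eq_cycleLengths hp, Equiv.Perm.parts_partition]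
  simp

lemma card_centralizer_eq (hp : p ∈ permsOfType c) :
    Nat.card (Subgroup.centralizer {p.2})
      = (∏ i : Fin n, ((i : ℕ) + 1) ^ c i) * ∏ i : Fin n, (c i).factorial := by
  rw [Equiv.Perm.nat_card_centralizer, prod_cycleType_eq hp, mul_right_comm, mul_comm]
  congr 1
  have hparts := parts_eq_cycleLengths hp
  have hone : 1 ∉ p.2.cycleType := fun h => by
    simpa using Equiv.Perm.one_lt_of_mem_cycleType h
  set f : ℕ → ℕ := fun k => (p.2.partition.parts.count k).factorial with hf
  have hsupp : Function.mulSupport f ⊆ {k | k ∈ p.2.partition.parts} := fun k hk => by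
    by_contra hk'
    refine hk ?_
    simp only [hf]
    rw [Multiset.count_eq_zero_of_notMem (by simpa using hk'), Nat.factorial_zero]
  have h1 : ∏ᶠ k, f k = ∏ i : Fin n, (c i).factorial := by
    rw [finprod_eq_prod_of_mulSupport_subset (s := Finset.univ.map
      ⟨fun i : Fin n => (i : ℕ) + 1, fun i j h => Fin.ext (Nat.succ.inj h)⟩) f]
    · rw [Finset.prod_map]
      refine Finset.prod_congr rfl fun i _ => ?_
      change (Multiset.count ((i : ℕ) + 1) p.2.partition.parts).factorial = _
      rw [hparts, count_cycleLengths]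
    · intro k hk
      have := hsupp hk
      rw [Set.mem_ofPred_eq, hparts] at this
      obtain ⟨i, rfl⟩ := mem_cycleLengths this
      exact Finset.mem_coe.2 (Finset.mem_map.2 ⟨i, Finset.mem_univ _, rfl⟩)
  -- The index `1` is separated because the centralizer formula counts permutations of the fixed
  -- points in a factor of its own.
  rw [← h1, finprod_eq_prod_of_mulSupport_subset (s := insert 1 p.2.cycleType.toFinset) f,
    Finset.prod_insert (by simpa using hone)]
  · congr 1
    · simp only [hf, Equiv.Perm.parts_partition, Equiv.Perm.sum_cycleType, Multiset.count_add,
        Multiset.count_eq_zero_of_notMem hone, Multiset.count_replicate_self, zero_add]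
    · refine Finset.prod_congr rfl fun k hk => ?_
      have hk1 : 1 ≠ k := fun h => hone (by rw [h]; simpa using hk)
      simp only [hf, Equiv.Perm.parts_partition, Multiset.count_add, Multiset.count_replicate,
        if_neg hk1, add_zero]
  · intro k hk
    have := hsupp hk
    rw [Set.mem_ofPred_eq, Equiv.Perm.parts_partition, Multiset.mem_add] at this
    rcases this with h | h
    · simp [h]
    · simp [Multiset.eq_of_mem_replicate h]

/-- The logarithm of the product of the cycle lengths. -/
noncomputable def logWeight (c : Fin n → ℕ) : ℝ :=
  ∑ i : Fin n, (c i : ℝ) * Real.log ((i : ℕ) + 1)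

/-- The logarithm of the number of ways to permute cycles of equal length. -/
noncomputable def logExcess (c : Fin n → ℕ) : ℝ :=
  ∑ i : Fin n, Real.log ((c i).factorial)

lemma log_prod_pow (c : Fin n → ℕ) :
    Real.log ((∏ i : Fin n, ((i : ℕ) + 1) ^ c i : ℕ) : ℝ) = logWeight c := by
  push_cast
  rw [Real.log_prod fun i _ => by positivity]
  simp [logWeight, Real.log_pow]

lemma logWeight_le_log_numFactorizations (hp : p ∈ permsOfType c) :
    logWeight c ≤ Real.log (numFactorizations p) := by
  have h := prod_cycleType_le_card_factorizations p.2
  rw [prod_cycleType_eq hp] at h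
  rw [← log_prod_pow]
  refine Real.log_le_log ?_ (by exact_mod_cast h)
  exact_mod_cast Finset.prod_pos fun i _ => by positivity

lemma log_numFactorizations_le (hp : p ∈ permsOfType c) :
    Real.log (numFactorizations p) ≤ logWeight c + logExcess c := by
  have h := card_factorizations_le_card_centralizer p.2
  have h0 := prod_cycleType_le_card_factorizations p.2
  rw [prod_cycleType_eq hp] at h0
  have hpos : 0 < ∏ i : Fin n, ((i : ℕ) + 1) ^ c i := Finset.prod_pos fun i _ => by positivity
  have hex : logExcess c = Real.log ((∏ i : Fin n, (c i).factorial : ℕ) : ℝ) := by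
    push_cast
    rw [Real.log_prod fun i _ => by positivity, logExcess]
  rw [card_centralizer_eq hp] at h
  rw [← log_prod_pow, hex, ← Real.log_mul (by exact_mod_cast hpos.ne')
    (by exact_mod_cast (Finset.prod_pos fun i _ => Nat.factorial_pos _).ne')]
  refine Real.log_le_log ?_ (by exact_mod_cast h)
  exact_mod_cast hpos.trans_le h0

end PermsOfType
-- Asymptotics of the mean and variance sums.
section LogSums

/-- A common majorant for the errors in both sum estimates. With `log x ≤ 4 x ^ (1/4)` the numerator
is at most `(16 + 4 + 1) √x`, and `x² ≤ 4 (k + 1)²`, whence `84`. -/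
lemma summable_log_sq_div_sq :
    Summable fun k : ℕ => (Real.log (k + 2) ^ 2 + Real.log (k + 2) + 1) / ((k : ℝ) + 1) ^ 2 := by
  have hs : Summable fun k : ℕ => 84 * (1 / ((k + 2 : ℕ) : ℝ) ^ (3 / 2 : ℝ)) :=
    ((summable_nat_add_iff 2).2 (Real.summable_one_div_nat_rpow.2 (by norm_num))).mul_left 84
  refine Summable.of_nonneg_of_le (fun k => ?_) (fun k => ?_) hs
  · have : 0 ≤ Real.log ((k : ℝ) + 2) := Real.log_nonneg (by linarith [k.cast_nonneg (α := ℝ)])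
    positivity
  · have hk : (0 : ℝ) ≤ k := k.cast_nonneg
    have hl : 0 ≤ Real.log ((k : ℝ) + 2) := Real.log_nonneg (by linarith)
    set x : ℝ := (k : ℝ) + 2 with hx
    set s : ℝ := x ^ (1 / 4 : ℝ) with hsdef
    have hs1 : 1 ≤ s := Real.one_le_rpow (by linarith) (by norm_num)
    have hlog : Real.log x ≤ 4 * s := by
      have := Real.log_le_rpow_div (x := x) (by linarith) (ε := 1 / 4) (by norm_num)
      linarith
    have hs4 : s ^ 2 * x ^ (3 / 2 : ℝ) = x ^ 2 := by
      rw [hsdef, ← Real.rpow_natCast, ← Real.rpow_mul (by linarith), ← Real.rpow_add (by linarith),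
        ← Real.rpow_natCast]
      norm_num
    have hnum : Real.log x ^ 2 + Real.log x + 1 ≤ 21 * s ^ 2 := by nlinarith
    have hden : x ^ 2 ≤ 4 * ((k : ℝ) + 1) ^ 2 := by rw [hx]; nlinarith
    have hxp : 0 < x ^ (3 / 2 : ℝ) := Real.rpow_pos_of_pos (by linarith) _
    have hcast : ((k + 2 : ℕ) : ℝ) = x := by push_cast; rfl
    rw [hcast, mul_one_div, div_le_div_iff₀ (by positivity) hxp]
    nlinarith [mul_le_mul_of_nonneg_right hnum hxp.le]

lemma abs_sum_range_le_of_le_tsum {f g : ℕ → ℝ} (hg : Summable g) (h : ∀ k, |f k| ≤ g k) (m : ℕ) :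
    |∑ k ∈ Finset.range m, f k| ≤ ∑' k, g k :=
  (Finset.abs_sum_le_sum_abs _ _).trans ((Finset.sum_le_sum fun k _ => h k).trans
    (hg.sum_le_tsum _ fun k _ => (abs_nonneg _).trans (h k)))

lemma log_succ_sub_log_bounds (k : ℕ) :
    1 / ((k : ℝ) + 2) ≤ Real.log (k + 2) - Real.log (k + 1) ∧
      Real.log (k + 2) - Real.log (k + 1) ≤ 1 / ((k : ℝ) + 1) := by
  have hk : (0 : ℝ) ≤ k := k.cast_nonneg
  rw [← Real.log_div (by positivity) (by positivity)]
  constructor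
  · have := Real.one_sub_inv_le_log_of_pos (x := ((k : ℝ) + 2) / (k + 1)) (by positivity)
    refine le_trans (le_of_eq ?_) this
    field_simp
    ring
  · have := Real.log_le_sub_one_of_pos (x := ((k : ℝ) + 2) / (k + 1)) (by positivity)
    refine this.trans (le_of_eq ?_)
    field_simp
    ring

/-- The main terms are written as telescoping sums, and the termwise differences are absolutely
summable. -/
lemma exists_abs_sum_log_div_sub_le :
    ∃ C : ℝ, ∀ m : ℕ,
      |∑ k ∈ Finset.range (m + 1), Real.log (k + 1) / ((k : ℝ) + 1)
        - 1 / 2 * Real.log (m + 1) ^ 2| ≤ C ∧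
      |∑ k ∈ Finset.range (m + 1), Real.log (k + 1) ^ 2 / ((k : ℝ) + 1)
        - 1 / 3 * Real.log (m + 1) ^ 3| ≤ C := by
  refine ⟨∑' k : ℕ, (Real.log (k + 2) ^ 2 + Real.log (k + 2) + 1) / ((k : ℝ) + 1) ^ 2,
    fun m => ⟨?_, ?_⟩⟩
  rotate_left
  · have htel := Finset.sum_range_sub (fun k : ℕ => 1 / 3 * Real.log ((k : ℝ) + 1) ^ 3) m
    simp only [Nat.cast_zero, zero_add, Real.log_one, ne_eq, OfNat.ofNat_ne_zero,
      not_false_eq_true, zero_pow, mul_zero, sub_zero] at htel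
    rw [← htel, Finset.sum_range_succ', ← sub_add_eq_add_sub, ← Finset.sum_sub_distrib]
    simp only [Nat.cast_zero, zero_add, Real.log_one, ne_eq, OfNat.ofNat_ne_zero,
      not_false_eq_true, zero_pow, zero_div, add_zero]
    refine abs_sum_range_le_of_le_tsum summable_log_sq_div_sq (fun k => ?_) m
    have hk : (0 : ℝ) ≤ k := k.cast_nonneg
    obtain ⟨h1, h2⟩ := log_succ_sub_log_bounds k
    have e : ((k + 1 : ℕ) : ℝ) + 1 = k + 2 := by push_cast; ring
    rw [e]
    have hl : 0 ≤ Real.log ((k : ℝ) + 2) := Real.log_nonneg (by linarith)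
    set y := Real.log ((k : ℝ) + 2)
    obtain ⟨d, hd⟩ : ∃ d, d = y - Real.log ((k : ℝ) + 1) := ⟨_, rfl⟩
    have hx : Real.log ((k : ℝ) + 1) = y - d := by linarith
    rw [← hd] at h1 h2
    rw [hx]
    set q : ℝ := 1 / ((k : ℝ) + 1) with hq
    set p : ℝ := 1 / ((k : ℝ) + 2) with hp
    have hp0 : 0 < p := by positivity
    have hq1 : q ≤ 1 := by rw [hq, div_le_one (by positivity)]; linarith
    have hpq : q - p ≤ q ^ 2 := by
      rw [hq, hp, div_sub_div _ _ (by positivity) (by positivity), div_pow,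
        div_le_div_iff₀ (by positivity) (by positivity)]
      nlinarith
    have e1 : y ^ 2 / ((k : ℝ) + 2) = y ^ 2 * p := by rw [hp]; ring
    have e2 : (y ^ 2 + y + 1) / ((k : ℝ) + 1) ^ 2 = (y ^ 2 + y + 1) * q ^ 2 := by
      rw [hq, div_pow, one_pow]; ring
    rw [e1, e2]
    have hd2 : d ^ 2 ≤ q ^ 2 := by nlinarith
    have hd3 : d ^ 3 ≤ q ^ 2 := by nlinarith [sq_nonneg d]
    have hd30 : 0 ≤ d ^ 3 := by have : 0 ≤ d := hp0.le.trans h1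
                                positivity
    -- The termwise difference is `-y² (d - p) + y d² - d³ / 3`, and each piece is bounded by a
    -- multiple of `q²`.
    have a1 : y ^ 2 * (d - p) ≤ y ^ 2 * q ^ 2 := by gcongr; linarith
    have a2 : 0 ≤ y ^ 2 * (d - p) := mul_nonneg (sq_nonneg _) (by linarith)
    have a3 : y * d ^ 2 ≤ y * q ^ 2 := by gcongr
    have a4 : 0 ≤ y * d ^ 2 := by positivity
    have a5 : 0 ≤ y * q ^ 2 := by positivity
    have a6 : 0 ≤ y ^ 2 * q ^ 2 := by positivity
    have a7 : 0 ≤ q ^ 2 := by positivity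
    rw [abs_le]
    constructor <;> nlinarith
  · have htel := Finset.sum_range_sub (fun k : ℕ => 1 / 2 * Real.log ((k : ℝ) + 1) ^ 2) m
    simp only [Nat.cast_zero, zero_add, Real.log_one, ne_eq, OfNat.ofNat_ne_zero,
      not_false_eq_true, zero_pow, mul_zero, sub_zero] at htel
    rw [← htel, Finset.sum_range_succ', ← sub_add_eq_add_sub, ← Finset.sum_sub_distrib]
    simp only [Nat.cast_zero, zero_add, Real.log_one, zero_div, add_zero]
    refine abs_sum_range_le_of_le_tsum summable_log_sq_div_sq (fun k => ?_) m
    have hk : (0 : ℝ) ≤ k := k.cast_nonneg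
    obtain ⟨h1, h2⟩ := log_succ_sub_log_bounds k
    have e : ((k + 1 : ℕ) : ℝ) + 1 = k + 2 := by push_cast; ring
    rw [e]
    have hl : 0 ≤ Real.log ((k : ℝ) + 2) := Real.log_nonneg (by linarith)
    set y := Real.log ((k : ℝ) + 2)
    obtain ⟨d, hd⟩ : ∃ d, d = y - Real.log ((k : ℝ) + 1) := ⟨_, rfl⟩
    have hx : Real.log ((k : ℝ) + 1) = y - d := by linarith
    rw [← hd] at h1 h2
    rw [hx]
    set q : ℝ := 1 / ((k : ℝ) + 1) with hq
    set p : ℝ := 1 / ((k : ℝ) + 2) with hp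
    have hp0 : 0 < p := by positivity
    have hpq : q - p ≤ q ^ 2 := by
      rw [hq, hp, div_sub_div _ _ (by positivity) (by positivity), div_pow,
        div_le_div_iff₀ (by positivity) (by positivity)]
      nlinarith
    have e1 : y / ((k : ℝ) + 2) = y * p := by rw [hp]; ring
    have e2 : (y ^ 2 + y + 1) / ((k : ℝ) + 1) ^ 2 = (y ^ 2 + y + 1) * q ^ 2 := by
      rw [hq, div_pow, one_pow]; ring
    rw [e1, e2]
    have hd2 : d ^ 2 ≤ q ^ 2 := by nlinarith
    have a1 : y * (d - p) ≤ y * q ^ 2 := by gcongr; linarith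
    have a2 : 0 ≤ y * (d - p) := mul_nonneg hl (by linarith)
    have a5 : 0 ≤ y * q ^ 2 := by positivity
    have a6 : 0 ≤ y ^ 2 * q ^ 2 := by positivity
    have a7 : 0 ≤ q ^ 2 := by positivity
    rw [abs_le]
    constructor <;> nlinarith

end LogSums
open Filter Topology

/-! ### Characteristic functions of compound Poisson sums. -/

section CharacteristicFunctions

instance (n : ℕ) : IsProbabilityMeasure (cycleCountLaw n) := by
  unfold cycleCountLaw; infer_instance

lemma measurePreserving_cycleCount {n : ℕ} (i : Fin n) :
    MeasurePreserving (fun c : Fin n → ℕ => c i) (cycleCountLaw n)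
      (poissonMeasure (1 / ((i : ℕ) + 1 : ℝ≥0))) :=
  measurePreserving_eval (fun i : Fin n => poissonMeasure (1 / ((i : ℕ) + 1 : ℝ≥0))) i

lemma charFun_map_logWeight (n : ℕ) (u : ℝ) :
    charFun ((cycleCountLaw n).map logWeight) u =
      Complex.exp (∑ k ∈ Finset.range n,
        ((1 / ((k : ℝ) + 1) : ℝ) : ℂ) *
          (Complex.exp (((u * Real.log (k + 1) : ℝ) : ℂ) * Complex.I) - 1)) := by
  have hind := iIndepFun_pi (μ := fun i : Fin n => poissonMeasure (1 / ((i : ℕ) + 1 : ℝ≥0)))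
    (X := fun (i : Fin n) (k : ℕ) => Real.log ((i : ℕ) + 1) * (k : ℝ))
    fun i => Measurable.aemeasurable (by fun_prop)
  have hfun : (logWeight : (Fin n → ℕ) → ℝ)
      = fun c => ∑ i : Fin n, Real.log ((i : ℕ) + 1) * (c i : ℝ) := by
    ext c
    simp only [logWeight, mul_comm]
  rw [hfun, cycleCountLaw, hind.charFun_map_fun_sum_eq_prod
    fun i => Measurable.aemeasurable (by fun_prop), Finset.prod_apply, Complex.exp_sum,
    ← Fin.prod_univ_eq_prod_range (fun k => Complex.exp (((1 / ((k : ℝ) + 1) : ℝ) : ℂ) *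
          (Complex.exp (((u * Real.log (k + 1) : ℝ) : ℂ) * Complex.I) - 1)))]
  refine Finset.prod_congr rfl fun i _ => ?_
  have hmap : (Measure.pi fun i : Fin n => poissonMeasure (1 / ((i : ℕ) + 1 : ℝ≥0))).map
      (fun c => Real.log ((i : ℕ) + 1) * (c i : ℝ))
      = (poissonMeasure (1 / ((i : ℕ) + 1 : ℝ≥0))).map
        (fun k : ℕ => Real.log ((i : ℕ) + 1) * (k : ℝ)) := by
    rw [← (measurePreserving_cycleCount i).map_eq, Measure.map_map (by fun_prop) (by fun_prop)]
    rfl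
  rw [hmap, charFun_map_mul_comp (Measurable.aemeasurable (by fun_prop)),
    charFun_map_cast_poissonMeasure]
  push_cast
  rw [mul_comm (u : ℂ)]

lemma charFun_map_sub_div {Ω : Type*} [MeasurableSpace Ω] {μ : Measure Ω} {X : Ω → ℝ}
    (hX : Measurable X) (a b t : ℝ) :
    charFun (μ.map fun ω => (X ω - a) / b) t
      = Complex.exp (((-(t / b * a) : ℝ) : ℂ) * Complex.I) * charFun (μ.map X) (t / b) := by
  rw [charFun_apply_real, charFun_apply_real, integral_map (by fun_prop) (by fun_prop),
    integral_map (by fun_prop) (by fun_prop), ← integral_const_mul]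
  refine integral_congr_ae (Eventually.of_forall fun ω => ?_)
  simp only
  rw [← Complex.exp_add]
  congr 1
  push_cast
  ring

lemma norm_charFun_map_sub_le {Ω : Type*} [MeasurableSpace Ω] {μ : Measure Ω}
    [IsProbabilityMeasure μ] {X Y : Ω → ℝ} (hX : Measurable X) (hY : Measurable Y)
    (hXY : Integrable (fun ω => Y ω - X ω) μ) (t : ℝ) :
    ‖charFun (μ.map Y) t - charFun (μ.map X) t‖ ≤ |t| * ∫ ω, |Y ω - X ω| ∂μ := by
  have hint : ∀ Z : Ω → ℝ, Measurable Z →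
      Integrable (fun ω => Complex.exp ((t : ℂ) * (Z ω : ℂ) * Complex.I)) μ := fun Z hZ => by
    refine Integrable.of_bound (C := 1) (by fun_prop) (Eventually.of_forall fun ω => ?_)
    rw [← Complex.ofReal_mul, Complex.norm_exp_ofReal_mul_I]
  rw [charFun_apply_real, charFun_apply_real, integral_map (by fun_prop) (by fun_prop),
    integral_map (by fun_prop) (by fun_prop), ← integral_sub (hint Y hY) (hint X hX),
    ← integral_const_mul]
  refine norm_integral_le_of_norm_le (hXY.abs.const_mul _) (Eventually.of_forall fun ω => ?_)
  have h : Complex.exp ((t : ℂ) * (Y ω : ℂ) * Complex.I) - Complex.exp (t * X ω * Complex.I)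
      = Complex.exp (((t * X ω : ℝ) : ℂ) * Complex.I)
        * (Complex.exp (Complex.I * ((t * (Y ω - X ω) : ℝ) : ℂ)) - 1) := by
    rw [mul_sub, ← Complex.exp_add, mul_one]
    push_cast
    ring_nf
  rw [h, norm_mul, Complex.norm_exp_ofReal_mul_I, one_mul, ← abs_mul]
  exact Real.norm_exp_I_mul_ofReal_sub_one_le

/-- Second-order Taylor expansion of each exponential. The three errors are the cubic remainder, the
discrepancy of the mean from `m`, and that of the variance from `v`. -/
lemma norm_compoundPoisson_exponent_sub_le (N : Finset ℕ) (w l : ℕ → ℝ) (s m v : ℝ)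
    (hw : ∀ k ∈ N, 0 ≤ w k) (hl : ∀ k ∈ N, 0 ≤ l k) (hs : ∀ k ∈ N, |s| * l k ≤ 1) :
    ‖∑ k ∈ N, (w k : ℂ) * (Complex.exp (((s * l k : ℝ) : ℂ) * Complex.I) - 1)
        + ((-(s * m) : ℝ) : ℂ) * Complex.I + ((s ^ 2 / 2 * v : ℝ) : ℂ)‖
      ≤ |s| ^ 3 * ∑ k ∈ N, w k * l k ^ 3 + |s| * |∑ k ∈ N, w k * l k - m|
        + s ^ 2 / 2 * |∑ k ∈ N, w k * l k ^ 2 - v| := by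
  set z : ℕ → ℂ := fun k => ((s * l k : ℝ) : ℂ) * Complex.I with hz
  have hz2 : ∀ k, z k ^ 2 = -(((s * l k) ^ 2 : ℝ) : ℂ) := fun k => by
    simp only [hz, mul_pow, Complex.I_sq]
    push_cast
    ring
  have hdecomp : ∑ k ∈ N, (w k : ℂ) * (Complex.exp (z k) - 1)
        + ((-(s * m) : ℝ) : ℂ) * Complex.I + ((s ^ 2 / 2 * v : ℝ) : ℂ)
      = ∑ k ∈ N, (w k : ℂ) * (Complex.exp (z k) - (1 + z k + z k ^ 2 / 2))
        + ((s * (∑ k ∈ N, w k * l k - m) : ℝ) : ℂ) * Complex.I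
        - ((s ^ 2 / 2 * (∑ k ∈ N, w k * l k ^ 2 - v) : ℝ) : ℂ) := by
    have e1 : ((s * ∑ k ∈ N, w k * l k : ℝ) : ℂ) * Complex.I = ∑ k ∈ N, (w k : ℂ) * z k := by
      rw [Finset.mul_sum]
      push_cast
      rw [Finset.sum_mul]
      refine Finset.sum_congr rfl fun k _ => ?_
      simp only [hz]
      push_cast
      ring
    have e2 : ((s ^ 2 / 2 * ∑ k ∈ N, w k * l k ^ 2 : ℝ) : ℂ)
        = -∑ k ∈ N, (w k : ℂ) * (z k ^ 2 / 2) := by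
      rw [Finset.mul_sum, ← Finset.sum_neg_distrib]
      push_cast
      refine Finset.sum_congr rfl fun k _ => ?_
      rw [hz2]
      push_cast
      ring
    rw [mul_sub s, mul_sub (s ^ 2 / 2), Complex.ofReal_sub, Complex.ofReal_sub, sub_mul, e1, e2]
    have e3 : ∑ k ∈ N, (w k : ℂ) * (Complex.exp (z k) - (1 + z k + z k ^ 2 / 2))
        = ∑ k ∈ N, (w k : ℂ) * (Complex.exp (z k) - 1) - ∑ k ∈ N, (w k : ℂ) * z k
          - ∑ k ∈ N, (w k : ℂ) * (z k ^ 2 / 2) := by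
      rw [← Finset.sum_sub_distrib, ← Finset.sum_sub_distrib]
      exact Finset.sum_congr rfl fun k _ => by ring
    rw [e3, Complex.ofReal_neg]
    ring
  rw [hdecomp]
  refine (norm_sub_le _ _).trans (add_le_add ((norm_add_le _ _).trans (add_le_add ?_ ?_)) ?_)
  · rw [Finset.mul_sum]
    refine norm_sum_le_of_le _ fun k hk => ?_
    have hzn : ‖z k‖ = |s| * l k := by
      simp only [hz]
      rw [norm_mul, Complex.norm_I, mul_one, Complex.norm_real, Real.norm_eq_abs, abs_mul,
        abs_of_nonneg (hl k hk)]
    have hb := Complex.exp_bound (x := z k) (by rw [hzn]; exact hs k hk) (n := 3) (by norm_num)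
    simp only [Finset.sum_range_succ, Finset.sum_range_zero, Nat.factorial] at hb
    rw [norm_mul, Complex.norm_real, Real.norm_eq_abs, abs_of_nonneg (hw k hk)]
    have hb' : ‖Complex.exp (z k) - (1 + z k + z k ^ 2 / 2)‖ ≤ ‖z k‖ ^ 3 * 1 := by
      refine le_trans (le_of_eq ?_) (hb.trans (mul_le_mul_of_nonneg_left (by norm_num) (by positivity)))
      congr 1
      norm_num
    rw [mul_one, hzn] at hb'
    refine (mul_le_mul_of_nonneg_left hb' (hw k hk)).trans (le_of_eq ?_)
    ring
  · rw [norm_mul, Complex.norm_I, mul_one, Complex.norm_real, Real.norm_eq_abs, abs_mul]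
  · rw [Complex.norm_real, Real.norm_eq_abs, abs_mul, abs_of_nonneg (by positivity)]

end CharacteristicFunctions

/-! ### The factorial excess is bounded in mean. -/

section Excess

/-- The bound vanishes at `0` and `1`, so its Poisson mean is quadratic in the parameter, hence
summable over parameters `1 / k`. -/
lemma log_factorial_le (k : ℕ) : Real.log (k.factorial) ≤ (k : ℝ) * (k - 1) := by
  induction k with
  | zero => simp
  | succ k ih =>
    rw [Nat.factorial_succ, Nat.cast_mul, Real.log_mul (by positivity) (by positivity)]
    have := Real.log_le_sub_one_of_pos (x := ((k + 1 : ℕ) : ℝ)) (by positivity)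
    push_cast at this ⊢
    nlinarith [k.cast_nonneg (α := ℝ)]

lemma log_factorial_nonneg (k : ℕ) : 0 ≤ Real.log (k.factorial) :=
  Real.log_nonneg (by exact_mod_cast k.factorial_pos)

lemma hasSum_poisson_factorial_moment_two (r : ℝ≥0) :
    HasSum (fun k : ℕ => (Real.exp (-r) * (r : ℝ) ^ k / k.factorial) * ((k : ℝ) * (k - 1)))
      ((r : ℝ) ^ 2) := by
  rw [← hasSum_nat_add_iff' 2]
  have h := (hasSum_one_poissonMeasure r).mul_left ((r : ℝ) ^ 2)
  rw [mul_one] at h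
  rw [Finset.sum_range_succ, Finset.sum_range_one, Nat.cast_zero, Nat.cast_one, zero_mul, sub_self,
    mul_zero, mul_zero, mul_zero, add_zero, sub_zero]
  convert! h using 1
  funext k
  rw [Nat.factorial_succ, Nat.factorial_succ]
  have := k.factorial_pos
  push_cast
  field_simp
  ring

lemma integrable_log_factorial_poissonMeasure (r : ℝ≥0) :
    Integrable (fun k : ℕ => Real.log (k.factorial)) (poissonMeasure r) ∧
      ∫ k, Real.log (k.factorial) ∂(poissonMeasure r) ≤ (r : ℝ) ^ 2 := by
  have h := hasSum_poisson_factorial_moment_two r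
  have hnn : ∀ k : ℕ, 0 ≤ (k : ℝ) * (k - 1) := fun k =>
    (log_factorial_nonneg k).trans (log_factorial_le k)
  have hI : Integrable (fun k : ℕ => (k : ℝ) * (k - 1)) (poissonMeasure r) := by
    rw [integrable_poissonMeasure_iff]
    refine h.summable.congr fun k => ?_
    rw [Real.norm_of_nonneg (hnn k)]
  have hI' : Integrable (fun k : ℕ => Real.log (k.factorial)) (poissonMeasure r) :=
    hI.mono' .of_discrete (Eventually.of_forall fun k => by
      rw [Real.norm_of_nonneg (log_factorial_nonneg k)]
      exact log_factorial_le k)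
  refine ⟨hI', (integral_mono hI' hI log_factorial_le).trans (le_of_eq ?_)⟩
  rw [integral_poissonMeasure]
  simpa only [smul_eq_mul] using h.tsum_eq

lemma exists_integral_logExcess_le :
    ∃ C : ℝ, ∀ n : ℕ, Integrable (logExcess (n := n)) (cycleCountLaw n) ∧
      ∫ c, logExcess c ∂(cycleCountLaw n) ≤ C := by
  have hsum : Summable fun k : ℕ => 1 / ((k : ℝ) + 1) ^ 2 := by
    have := (summable_nat_add_iff 1).2 (Real.summable_one_div_nat_pow.2 (one_lt_two))
    simpa using this
  refine ⟨∑' k : ℕ, 1 / ((k : ℝ) + 1) ^ 2, fun n => ?_⟩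
  have hi : ∀ i : Fin n, Integrable (fun c : Fin n → ℕ => Real.log ((c i).factorial))
      (cycleCountLaw n) := fun i =>
    (measurePreserving_cycleCount i).integrable_comp_of_integrable
      (integrable_log_factorial_poissonMeasure _).1
  refine ⟨integrable_finsetSum _ fun i _ => hi i, ?_⟩
  unfold logExcess
  rw [integral_finsetSum _ fun i _ => hi i]
  calc ∑ i : Fin n, ∫ c, Real.log ((c i).factorial) ∂(cycleCountLaw n)
      ≤ ∑ i : Fin n, 1 / (((i : ℕ) : ℝ) + 1) ^ 2 := by
        refine Finset.sum_le_sum fun i _ => ?_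
        have h := (integrable_log_factorial_poissonMeasure (1 / ((i : ℕ) + 1 : ℝ≥0))).2
        rw [← (measurePreserving_cycleCount i).map_eq,
          integral_map Measurable.of_discrete.aemeasurable .of_discrete] at h
        refine h.trans (le_of_eq ?_)
        push_cast
        rw [div_pow, one_pow]
    _ = ∑ k ∈ Finset.range n, 1 / ((k : ℝ) + 1) ^ 2 :=
        Fin.sum_univ_eq_sum_range (fun k => 1 / ((k : ℝ) + 1) ^ 2) n
    _ ≤ _ := hsum.sum_le_tsum _ fun k _ => by positivity

lemma logExcess_nonneg {n : ℕ} (c : Fin n → ℕ) : 0 ≤ logExcess c :=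
  Finset.sum_nonneg fun _ _ => log_factorial_nonneg _

end Excess
-- Gaussian limit and transfer to random permutations.
section Limit

lemma tendsto_log_natCast_atTop : Tendsto (fun n : ℕ => Real.log n) atTop atTop :=
  Real.tendsto_log_atTop.comp tendsto_natCast_atTop_atTop

lemma sqrt_third_mul_cube {L : ℝ} (hL : 0 ≤ L) :
    Real.sqrt (1 / 3 * L ^ 3) = L * Real.sqrt (L / 3) := by
  rw [show 1 / 3 * L ^ 3 = L ^ 2 * (L / 3) by ring, Real.sqrt_mul (sq_nonneg L), Real.sqrt_sq hL]

lemma tendsto_div_sqrt_third_mul_cube :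
    Tendsto (fun L : ℝ => L / Real.sqrt (1 / 3 * L ^ 3)) atTop (𝓝 0) := by
  have h : Tendsto (fun L : ℝ => (Real.sqrt (L / 3))⁻¹) atTop (𝓝 0) :=
    tendsto_inv_atTop_zero.comp
      (Real.tendsto_sqrt_atTop.comp (tendsto_id.atTop_div_const (by norm_num)))
  refine h.congr' ?_
  filter_upwards [eventually_gt_atTop 0] with L hL
  rw [sqrt_third_mul_cube hL.le, div_mul_eq_div_div, div_self hL.ne', one_div]

lemma tendsto_inv_sqrt_third_mul_cube :
    Tendsto (fun L : ℝ => (Real.sqrt (1 / 3 * L ^ 3))⁻¹) atTop (𝓝 0) := by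
  have h := tendsto_div_sqrt_third_mul_cube.mul tendsto_inv_atTop_zero
  rw [zero_mul] at h
  refine h.congr' ?_
  filter_upwards [eventually_gt_atTop 0] with L hL
  field_simp

lemma tendsto_charFun_normalized_logWeight (t : ℝ) :
    Tendsto (fun n : ℕ => charFun ((cycleCountLaw n).map fun c =>
      (logWeight c - 1 / 2 * Real.log n ^ 2) / Real.sqrt (1 / 3 * Real.log n ^ 3)) t) atTop
      (𝓝 (charFun (gaussianReal 0 1) t)) := by
  obtain ⟨C, hC⟩ := exists_abs_sum_log_div_sub_le
  have hgauss : charFun (gaussianReal 0 1) t = Complex.exp (((-(t ^ 2 / 2) : ℝ) : ℂ)) := by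
    rw [charFun_gaussianReal]
    congr 1
    push_cast
    ring
  rw [hgauss]
  simp_rw [charFun_map_sub_div (Measurable.of_discrete (f := logWeight)), charFun_map_logWeight,
    ← Complex.exp_add]
  refine (Complex.continuous_exp.tendsto _).comp ?_
  rw [tendsto_iff_norm_sub_tendsto_zero]
  set b : ℝ → ℝ := fun L => Real.sqrt (1 / 3 * L ^ 3) with hb
  have hLb : Tendsto (fun L => L / b L) atTop (𝓝 0) := tendsto_div_sqrt_third_mul_cube
  have hbi : Tendsto (fun L => (b L)⁻¹) atTop (𝓝 0) := tendsto_inv_sqrt_third_mul_cube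
  -- This is the three-term error at `s = t / b L`, with the cubic sum bounded by `L * (b L ^ 2 +
  -- C)`.
  have hbound : Tendsto (fun L => |t| ^ 3 * (L / b L * (1 + C * (b L)⁻¹ * (b L)⁻¹))
      + |t| * C * (b L)⁻¹ + t ^ 2 / 2 * C * ((b L)⁻¹ * (b L)⁻¹)) atTop (𝓝 0) := by
    have h1 : Tendsto (fun L => |t| ^ 3 * (L / b L * (1 + C * (b L)⁻¹ * (b L)⁻¹))) atTop (𝓝 0) := by
      simpa using (hLb.mul ((tendsto_const_nhds (x := (1 : ℝ))).add
        ((hbi.const_mul C).mul hbi))).const_mul (|t| ^ 3)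
    have h2 : Tendsto (fun L => |t| * C * (b L)⁻¹) atTop (𝓝 0) := by
      simpa using hbi.const_mul (|t| * C)
    have h3 : Tendsto (fun L => t ^ 2 / 2 * C * ((b L)⁻¹ * (b L)⁻¹)) atTop (𝓝 0) := by
      simpa using (hbi.mul hbi).const_mul (t ^ 2 / 2 * C)
    simpa using (h1.add h2).add h3
  refine squeeze_zero' (Eventually.of_forall fun n => norm_nonneg _) ?_
    (hbound.comp tendsto_log_natCast_atTop)
  have hev : ∀ᶠ L in atTop, |t| * (L / b L) ≤ 1 := by
    have := hLb.const_mul |t|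
    rw [mul_zero] at this
    exact this.eventually_le_const one_pos
  filter_upwards [tendsto_log_natCast_atTop.eventually hev, eventually_ge_atTop 2] with n hn hn2
  obtain ⟨m, rfl⟩ : ∃ m, n = m + 1 := ⟨n - 1, by omega⟩
  obtain ⟨hC1, hC2⟩ := hC m
  simp only [Function.comp_apply]
  have hcast : ((m + 1 : ℕ) : ℝ) = m + 1 := by push_cast; rfl
  rw [hcast] at hn ⊢
  have hm : (1 : ℝ) ≤ m := by exact_mod_cast (by omega : 1 ≤ m)
  have hLpos : 0 < Real.log ((m : ℝ) + 1) := Real.log_pos (by linarith)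
  set L : ℝ := Real.log ((m : ℝ) + 1) with hL
  have hb0 : 0 < b L := Real.sqrt_pos.2 (by positivity)
  have hb2 : b L ^ 2 = 1 / 3 * L ^ 3 := Real.sq_sqrt (by positivity)
  have hlk : ∀ k ∈ Finset.range (m + 1), 0 ≤ Real.log ((k : ℝ) + 1) ∧ Real.log ((k : ℝ) + 1) ≤ L :=
    fun k hk => by
      have h1 : (k : ℝ) ≤ m := by exact_mod_cast Nat.lt_succ_iff.1 (Finset.mem_range.1 hk)
      have h0 : (0 : ℝ) ≤ k := k.cast_nonneg
      exact ⟨Real.log_nonneg (by linarith), Real.log_le_log (by linarith) (by linarith)⟩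
  have habs : |t / b L| = |t| / b L := by rw [abs_div, abs_of_pos hb0]
  have key := norm_compoundPoisson_exponent_sub_le (Finset.range (m + 1))
    (fun k => 1 / ((k : ℝ) + 1)) (fun k => Real.log ((k : ℝ) + 1)) (t / b L)
    (1 / 2 * L ^ 2) (1 / 3 * L ^ 3) (fun k _ => by positivity) (fun k hk => (hlk k hk).1)
    (fun k hk => by
      rw [habs]
      refine le_trans ?_ hn
      rw [mul_div_assoc', div_mul_eq_mul_div]
      gcongr
      exact (hlk k hk).2)
  have hvar : (t / b L) ^ 2 / 2 * (1 / 3 * L ^ 3) = t ^ 2 / 2 := by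
    rw [← hb2]
    field_simp
  have e1 : ∀ k : ℕ, 1 / ((k : ℝ) + 1) * Real.log ((k : ℝ) + 1)
      = Real.log ((k : ℝ) + 1) / ((k : ℝ) + 1) := fun k => by ring
  have e2 : ∀ k : ℕ, 1 / ((k : ℝ) + 1) * Real.log ((k : ℝ) + 1) ^ 2
      = Real.log ((k : ℝ) + 1) ^ 2 / ((k : ℝ) + 1) := fun k => by ring
  simp only [hvar, e1, e2, habs] at key
  have hcube : ∑ k ∈ Finset.range (m + 1), 1 / ((k : ℝ) + 1) * Real.log ((k : ℝ) + 1) ^ 3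
      ≤ L * (b L ^ 2 + C) := by
    calc _ ≤ ∑ k ∈ Finset.range (m + 1), L * (Real.log ((k : ℝ) + 1) ^ 2 / ((k : ℝ) + 1)) := by
          refine Finset.sum_le_sum fun k hk => ?_
          rw [← e2, pow_succ', ← mul_assoc, mul_comm (1 / ((k : ℝ) + 1)), mul_assoc]
          exact mul_le_mul_of_nonneg_right (hlk k hk).2 (by positivity)
      _ ≤ _ := by
          rw [← Finset.mul_sum, hb2]
          refine mul_le_mul_of_nonneg_left ?_ hLpos.le
          linarith [(abs_le.1 hC2).2]
  calc _ ≤ _ := le_trans (le_of_eq ?_) key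
    _ ≤ (|t| / b L) ^ 3 * (L * (b L ^ 2 + C)) + |t| / b L * C + (t / b L) ^ 2 / 2 * C := by
        gcongr
    _ = _ := by
        rw [div_pow, div_pow]
        field_simp
  congr 1
  rw [Complex.ofReal_neg (t ^ 2 / 2), sub_neg_eq_add, add_comm (Complex.ofReal _ * Complex.I)]

/-- The excess divided by the diverging normalization tends to `0` in mean, and characteristic
functions are Lipschitz in the L¹ distance. -/
lemma tendsto_charFun_normalized_logWeight_add_logExcess (t : ℝ) :
    Tendsto (fun n : ℕ => charFun ((cycleCountLaw n).map fun c =>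
      (logWeight c + logExcess c - 1 / 2 * Real.log n ^ 2) / Real.sqrt (1 / 3 * Real.log n ^ 3)) t)
      atTop (𝓝 (charFun (gaussianReal 0 1) t)) := by
  obtain ⟨C, hC⟩ := exists_integral_logExcess_le
  refine (tendsto_iff_of_dist ?_).1 (tendsto_charFun_normalized_logWeight t)
  have hlim : Tendsto (fun n : ℕ => |t| * (C * (Real.sqrt (1 / 3 * Real.log n ^ 3))⁻¹)) atTop
      (𝓝 0) := by
    simpa using ((tendsto_inv_sqrt_third_mul_cube.comp tendsto_log_natCast_atTop).const_mul
      C).const_mul |t|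
  refine squeeze_zero (fun n => dist_nonneg) (fun n => ?_) hlim
  have hdiff : ∀ c : Fin n → ℕ,
      (logWeight c + logExcess c - 1 / 2 * Real.log n ^ 2) / Real.sqrt (1 / 3 * Real.log n ^ 3)
        - (logWeight c - 1 / 2 * Real.log n ^ 2) / Real.sqrt (1 / 3 * Real.log n ^ 3)
      = logExcess c * (Real.sqrt (1 / 3 * Real.log n ^ 3))⁻¹ := fun c => by ring
  rw [dist_comm, dist_eq_norm]
  refine (norm_charFun_map_sub_le .of_discrete .of_discrete ?_ t).trans ?_
  · simp only [hdiff]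
    exact (hC n).1.mul_const _
  · have hnn : ∀ c : Fin n → ℕ, |logExcess c * (Real.sqrt (1 / 3 * Real.log n ^ 3))⁻¹|
        = logExcess c * (Real.sqrt (1 / 3 * Real.log n ^ 3))⁻¹ := fun c =>
      abs_of_nonneg (mul_nonneg (logExcess_nonneg c) (by positivity))
    simp only [hdiff, hnn]
    rw [integral_mul_const]
    gcongr
    exact (hC n).2

/-- Lévy's continuity theorem; without atoms, the boundary of a half-line is null for the limit. -/
lemma tendsto_real_Iic_of_tendsto_charFun {μ : ℕ → Measure ℝ} [hμ : ∀ n, IsProbabilityMeasure (μ n)]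
    {ν : Measure ℝ} [IsProbabilityMeasure ν] [NullSingletonClass ν]
    (h : ∀ t, Tendsto (fun n => charFun (μ n) t) atTop (𝓝 (charFun ν t))) (x : ℝ) :
    Tendsto (fun n => (μ n).real (Set.Iic x)) atTop (𝓝 (cdf ν x)) := by
  let ν' : ProbabilityMeasure ℝ := ⟨ν, inferInstance⟩
  let μ' : ℕ → ProbabilityMeasure ℝ := fun n => ⟨μ n, hμ n⟩
  have hw : Tendsto μ' atTop (𝓝 ν') := ProbabilityMeasure.tendsto_of_tendsto_charFun h
  have hfr : ν (frontier (Set.Iic x)) = 0 := by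
    rw [frontier_Iic]
    exact measure_singleton x
  have := ProbabilityMeasure.tendsto_measure_of_null_frontier_of_tendsto' hw hfr
  rw [cdf_eq_real]
  exact (ENNReal.tendsto_toReal (measure_ne_top ν _)).comp this

lemma permLaw_apply (n : ℕ) (A : Set AnyPerm) :
    permLaw n A = ∫⁻ c, uniformOn (permsOfType c) A ∂(cycleCountLaw n) :=
  Measure.bind_apply (MeasurableSet.of_discrete) (Measurable.of_discrete.aemeasurable)

/-- The bounds on `log F` hold for every permutation of a given type, so only the support and total
mass of the conditional law matter. -/
lemma permLaw_apply_le {n : ℕ} {A : Set AnyPerm} {B : Set (Fin n → ℕ)}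
    (h : ∀ c, ∀ p ∈ permsOfType c, p ∈ A → c ∈ B) : permLaw n A ≤ cycleCountLaw n B := by
  rw [permLaw_apply, ← lintegral_indicator_one (MeasurableSet.of_discrete (s := B))]
  refine lintegral_mono fun c => ?_
  have := isProbabilityMeasure_uniformOn (permsOfType_finite c) (permsOfType_nonempty c)
  by_cases hc : c ∈ B
  · simpa [hc] using prob_le_one
  · rw [(uniformOn_eq_zero_iff (permsOfType_finite c)).2]
    · exact zero_le
    · exact Set.eq_empty_iff_forall_notMem.2 fun p hp => hc (h c p hp.1 hp.2)

lemma le_permLaw_apply {n : ℕ} {A : Set AnyPerm} {B : Set (Fin n → ℕ)}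
    (h : ∀ c ∈ B, ∀ p ∈ permsOfType c, p ∈ A) : cycleCountLaw n B ≤ permLaw n A := by
  rw [permLaw_apply, ← lintegral_indicator_one (MeasurableSet.of_discrete (s := B))]
  refine lintegral_mono fun c => ?_
  by_cases hc : c ∈ B
  · rw [uniformOn_eq_one_of (permsOfType_finite c) (permsOfType_nonempty c) (h c hc)]
    simp [hc]
  · simp [hc]

end Limit
end InvFact

theorem mainTheorem5 (x : ℝ) :
    Filter.Tendsto
      (fun n : ℕ => (InvFact.permLaw n).real
        {p | (Real.log (InvFact.numFactorizations p) - (1 / 2) * Real.log n ^ 2)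
            / Real.sqrt ((1 / 3) * Real.log n ^ 3) ≤ x})
      Filter.atTop (nhds (cdf (gaussianReal 0 1) x)) := by
  have : NullSingletonClass (gaussianReal 0 1) := nullSingletonClass_gaussianReal one_ne_zero
  have hprob : ∀ (n : ℕ) (f : (Fin n → ℕ) → ℝ),
      IsProbabilityMeasure ((InvFact.cycleCountLaw n).map f) := fun n f =>
    Measure.isProbabilityMeasure_map Measurable.of_discrete.aemeasurable
  -- The order reverses: the smaller variable `logWeight` has the larger distribution function.
  have hupper := InvFact.tendsto_real_Iic_of_tendsto_charFun (hμ := fun n => hprob n _)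
    InvFact.tendsto_charFun_normalized_logWeight x
  have hlower := InvFact.tendsto_real_Iic_of_tendsto_charFun (hμ := fun n => hprob n _)
    InvFact.tendsto_charFun_normalized_logWeight_add_logExcess x
  refine tendsto_of_tendsto_of_tendsto_of_le_of_le hlower hupper (fun n => ?_) (fun n => ?_)
  · simp only
    rw [map_measureReal_apply .of_discrete measurableSet_Iic]
    refine ENNReal.toReal_mono ?_ (InvFact.le_permLaw_apply fun c hc p hp => ?_)
    · exact ne_top_of_le_ne_top (measure_ne_top (InvFact.cycleCountLaw n) Set.univ)
        (InvFact.permLaw_apply_le fun _ _ _ _ => Set.mem_univ _)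
    · rw [Set.mem_preimage, Set.mem_Iic] at hc
      rw [Set.mem_ofPred_eq]
      refine le_trans ?_ hc
      have := InvFact.log_numFactorizations_le hp
      gcongr
  · simp only
    rw [map_measureReal_apply .of_discrete measurableSet_Iic]
    refine ENNReal.toReal_mono (measure_ne_top _ _) (InvFact.permLaw_apply_le fun c p hp hA => ?_)
    rw [Set.mem_ofPred_eq] at hA
    rw [Set.mem_preimage, Set.mem_Iic]
    refine le_trans ?_ hA
    have := InvFact.logWeight_le_log_numFactorizations hp
    gcongr
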